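/- Consider the qualitative dueling bandit problem with $K=3$ arms. An instance is a triple $P=(P^{(1)},P^{(2)},P^{(3)})$ of probability distributions on the ordered feedback set $[L]=\{1,\dots,L\}$. Let $\mu_{i,j}=\mathbb{P}[X_i>X_j]+\tfrac12\mathbb{P}[X_i=X_j]$ for independent $X_i\sim P^{(i)}$, $X_j\sim P^{(j)}$; let $B_i=\frac1{K-1}\sum_{j\ne i}\mu_{i,j}$ be the Borda score of arm $i$, let $a^*$ be an arm with the largest Borda score, $\Delta_i=B_{a^*}-B_i$, and $\Delta_{\min}=\min_{i\ne a^*}\Delta_i$. In each round $t$ an algorithm chooses an arm $a_t$, possibly at random, depending on the past arms and feedback (and possibly on the total number $T$ of rounds), and observes a fresh sample from $P^{(a_t)}$. Its regret on the instance after $T$ rounds is $R_T=\sum_{t=1}^T\Delta_{a_t}$. Theorem. There are $L\in\mathbb{N}$ and absolute constants $c>0$ and $\Delta_0>0$ such that for every $\Delta\in(0,\Delta_0)$ there is a pair $(\Gamma,\Theta)$ of instances with $K=3$ arms and feedback set $[L]$ such that $\Theta$ has $\Delta_{\min}=\Delta$ and the following holds. Every algorithm whose regret $R_T^\Gamma$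 on $\Gamma$ satisfies $\mathbb{E}[R_T^\Gamma]=o(T^a)$ as $T\to\infty$ for every constant $a>0$ has regret $R_T^\Theta$ on $\Theta$ satisfying $$\liminf_{T\to\infty}\frac{\mathbb{E}[R_T^\Theta]}{\log T}\ \ge\ \frac{c}{\Delta^2}=\frac{c}{(\Delta_{\min})^2}.$$ -/

import Mathlib

open Filter Asymptotics

noncomputable section

namespace QDB

/-- An instance of the qualitative dueling bandit problem with `K` arms and the totally ordered
feedback set `Fin L`: every arm has a feedback distribution on `Fin L`, i.e. a vector in the
probability simplex. -/
abbrev Arms (K L : ℕ) : Type := Fin K → stdSimplex ℝ (Fin L)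

/-- The probability `ℙ[X > Y] + ℙ[X = Y] / 2` that `X` wins over `Y`, where `X ∼ x` and `Y ∼ y` are
independent. -/
def winProb {L : ℕ} (x y : stdSimplex ℝ (Fin L)) : ℝ :=
  ∑ k : Fin L, ∑ l : Fin L, x.1 k * y.1 l * (if l < k then 1 else if l = k then 1 / 2 else 0)

/-- The Borda score of an arm: its average winning probability against the other arms. -/
def bordaScore {K L : ℕ} (P : Arms K L) (i : Fin K) : ℝ :=
  (1 / ((K : ℝ) - 1)) * ∑ j ∈ Finset.univ.erase i, winProb (P i) (P j)

/-- Arm `a` is a Borda winner: it has the largest Borda score. -/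
def IsBordaWinner {K L : ℕ} (P : Arms K L) (a : Fin K) : Prop :=
  ∀ i, bordaScore P i ≤ bordaScore P a

/-- The Borda gap of an arm: the largest Borda score minus the score of the arm. -/
def bordaGap {K L : ℕ} (P : Arms K L) (i : Fin K) : ℝ :=
  (⨆ j, bordaScore P j) - bordaScore P i

/-- `d` is the smallest Borda gap among all arms other than the Borda winner. (If there are several
Borda winners, then this says `d = 0`, whichever of them is singled out.) -/
def IsMinBordaGap {K L : ℕ} (P : Arms K L) (d : ℝ) : Prop :=
  ∃ a, IsBordaWinner P a ∧ IsLeast (bordaGap P '' {i | i ≠ a}) d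

/-- The first `T` rounds of an interaction: in every round, the arm pulled and the feedback
observed. -/
abbrev History (K L T : ℕ) : Type := Fin T → Fin K × Fin L

/-- A (randomized) policy: given the history of the rounds `0, …, t - 1`, it gives the distribution
of the arm pulled in round `t`. -/
abbrev Policy (K L : ℕ) : Type := (t : ℕ) → History K L t → stdSimplex ℝ (Fin K)

/-- An algorithm: for every horizon `T`, the policy it runs when the number of rounds is `T`.
Algorithms that do not use the horizon are the constant functions. -/
abbrev Algorithm (K L : ℕ) : Type := ℕ → Policy K L

/-- The part of a history before round `t`. -/
def History.before {K L T : ℕ} (h : History K L T) (t : Fin T) : History K L t :=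
  fun s => h (Fin.castLE t.isLt.le s)

/-- The probability that the first `T` rounds are `h` when policy `π` interacts with `P`: in every
round the arm is drawn from `π` given the past, and then the feedback is drawn from the
distribution of that arm. -/
def historyProb {K L T : ℕ} (π : Policy K L) (P : Arms K L) (h : History K L T) : ℝ :=
  ∏ t : Fin T, (π t (h.before t)).1 (h t).1 * (P (h t).1).1 (h t).2

/-- The Borda regret accumulated along a history. -/
def regret {K L T : ℕ} (P : Arms K L) (h : History K L T) : ℝ :=
  ∑ t : Fin T, bordaGap P (h t).1

/-- The expected Borda regret of an algorithm on the instance `P` after `T` rounds. -/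
def expectedRegret {K L : ℕ} (alg : Algorithm K L) (P : Arms K L) (T : ℕ) : ℝ :=
  ∑ h : History K L T, historyProb (alg T) P h * regret P h

end QDB

end

open QDB

namespace QDB

/-! ### Law of a history and change of measure -/

variable {K L T : ℕ}

/-! Borda scores depend on all arms, so a clearly bad arm can decide which of two nearly tied good
arms wins. In the hard pair only arm 2 differs: its parameter is `q` in `Θ` and `1 - q` in `Γ`. Arm
0 wins in `Θ` and arm 1 in `Γ`, each by `Δ`. Only pulls of arm 2 separate the instances; each costs
at least 1/4 in `Θ` and yields information of order `Δ ^ 2`.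

Small regret on `Γ` makes it unlikely there that arm 0 is pulled in half of the rounds, while small
regret on `Θ` makes this typical. Reconciling the two takes information of order `log T`, hence
order `log T / Δ ^ 2` pulls of arm 2. `log_le_expectedRegret` is this change of measure;
`bordaScore_hardArms` supplies the gaps. -/

theorem historyProb_nonneg (π : Policy K L) (P : Arms K L) (h : History K L T) :
    0 ≤ historyProb π P h :=
  Finset.prod_nonneg fun t _ => mul_nonneg ((π t (h.before t)).2.1 _) ((P (h t).1).2.1 _)

theorem historyProb_snoc (π : Policy K L) (P : Arms K L) (h : History K L T) (x : Fin K × Fin L) :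
    historyProb (T := T + 1) π P (Fin.snoc (α := fun _ => Fin K × Fin L) h x) =
      historyProb π P h * ((π T h).1 x.1 * (P x.1).1 x.2) := by
  have hb : ∀ t : Fin T,
      History.before (T := T + 1) (Fin.snoc (α := fun _ => Fin K × Fin L) h x) t.castSucc =
        h.before t := by
    intro t
    funext s
    exact Fin.snoc_castSucc (α := fun _ => Fin K × Fin L) x h (Fin.castLE t.isLt.le s)
  have hl : History.before (T := T + 1) (Fin.snoc (α := fun _ => Fin K × Fin L) h x) (Fin.last T) =
        h := by
    funext s
    exact Fin.snoc_castSucc (α := fun _ => Fin K × Fin L) x h s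
  unfold historyProb
  rw [Fin.prod_univ_castSucc, hl]
  simp only [hb, Fin.snoc_castSucc, Fin.snoc_last, Fin.val_castSucc, Fin.val_last]

theorem sum_history_succ (F : History K L (T + 1) → ℝ) :
    ∑ h, F h = ∑ h : History K L T, ∑ x : Fin K × Fin L,
      F (Fin.snoc (α := fun _ => Fin K × Fin L) h x) := by
  rw [← (Fin.snocEquiv fun _ : Fin (T + 1) => Fin K × Fin L).sum_comp, Fintype.sum_prod_type_right]
  rfl

theorem sum_policy_mul (p : stdSimplex ℝ (Fin K)) (P : Arms K L) (g : Fin K × Fin L → ℝ) :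
    ∑ x : Fin K × Fin L, p.1 x.1 * (P x.1).1 x.2 * g x =
      ∑ a, p.1 a * ∑ l, (P a).1 l * g (a, l) := by
  simp only [Fintype.sum_prod_type, Finset.mul_sum, mul_assoc]

theorem sum_policy (p : stdSimplex ℝ (Fin K)) (P : Arms K L) :
    ∑ x : Fin K × Fin L, p.1 x.1 * (P x.1).1 x.2 = 1 := by
  have h := sum_policy_mul p P fun _ => 1
  simp only [mul_one, (P _).2.2, p.2.2] at h
  exact h

theorem sum_historyProb (π : Policy K L) (P : Arms K L) (T : ℕ) :
    ∑ h : History K L T, historyProb π P h = 1 := by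
  induction T with
  | zero => simp [historyProb]
  | succ T ih =>
    simp only [sum_history_succ, historyProb_snoc, ← Finset.mul_sum, sum_policy, mul_one, ih]

/-- A sum of rewards that are centred given the arm has mean zero. -/
theorem sum_historyProb_mul_sum_eq_zero (π : Policy K L) (P : Arms K L) (g : Fin K × Fin L → ℝ)
    (hg : ∀ a, ∑ l, (P a).1 l * g (a, l) = 0) (T : ℕ) :
    ∑ h : History K L T, historyProb π P h * ∑ t, g (h t) = 0 := by
  induction T with
  | zero => simp
  | succ T ih =>
    rw [sum_history_succ, ← ih]
    refine Finset.sum_congr rfl fun h _ => ?_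
    simp only [historyProb_snoc, Fin.sum_univ_castSucc, Fin.snoc_castSucc, Fin.snoc_last, mul_assoc]
    rw [← Finset.mul_sum]
    congr 1
    simp only [← mul_assoc, mul_add, Finset.sum_add_distrib]
    rw [← Finset.sum_mul, sum_policy, sum_policy_mul]
    simp [hg]

/-- The policy factors are common to both instances, so only the feedback likelihoods contribute. -/
theorem historyProb_eq_mul_exp (π : Policy K L) (P Q : Arms K L) (ℓ : Fin K × Fin L → ℝ)
    (hℓ : ∀ a l, (Q a).1 l = (P a).1 l * Real.exp (-ℓ (a, l))) (h : History K L T) :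
    historyProb π Q h = historyProb π P h * Real.exp (-∑ t, ℓ (h t)) := by
  rw [← Finset.sum_neg_distrib, Real.exp_sum]
  unfold historyProb
  rw [← Finset.prod_mul_distrib]
  refine Finset.prod_congr rfl fun t _ => ?_
  rw [hℓ, mul_assoc]

/-- A weak form of the Donsker–Varadhan inequality for histories. -/
theorem sum_historyProb_mul_sub_le (π : Policy K L) (P Q : Arms K L) (ℓ : Fin K × Fin L → ℝ)
    (hℓ : ∀ a l, (Q a).1 l = (P a).1 l * Real.exp (-ℓ (a, l))) (f : History K L T → ℝ) :
    ∑ h, historyProb π P h * f h - ∑ h : History K L T, historyProb π P h * ∑ t, ℓ (h t) ≤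
      ∑ h, historyProb π Q h * Real.exp (f h) - 1 := by
  rw [← sum_historyProb π P T, ← Finset.sum_sub_distrib, ← Finset.sum_sub_distrib]
  refine Finset.sum_le_sum fun h _ => ?_
  rw [historyProb_eq_mul_exp π P Q ℓ hℓ, mul_assoc, ← Real.exp_add]
  -- Pointwise `1 + x ≤ exp x`, with `x` equal to `f` minus the log-likelihood ratio, replaces the
  -- variational formula.
  have h1 := mul_le_mul_of_nonneg_left (Real.add_one_le_exp (-∑ t, ℓ (h t) + f h))
    (historyProb_nonneg π P h)
  linarith

/-! ### Regret, pull counts and the lower bound -/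

theorem bordaGap_eq_of_isBordaWinner {P : Arms K L} {a : Fin K} (ha : IsBordaWinner P a)
    (i : Fin K) : bordaGap P i = bordaScore P a - bordaScore P i := by
  have : Nonempty (Fin K) := ⟨a⟩
  have : ⨆ j, bordaScore P j = bordaScore P a :=
    le_antisymm (ciSup_le ha) (le_ciSup (Set.finite_range _).bddAbove a)
  rw [bordaGap, this]

/-- The number of rounds in which arm `a` is pulled. -/
def pulls (a : Fin K) (h : History K L T) : ℝ := ∑ t, if (h t).1 = a then 1 else 0

theorem pulls_nonneg (a : Fin K) (h : History K L T) : 0 ≤ pulls a h :=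
  Finset.sum_nonneg fun t _ => by split_ifs <;> norm_num

theorem mul_pulls_le_regret {P : Arms K L} {a : Fin K} {d : ℝ} (hP : ∀ i, 0 ≤ bordaGap P i)
    (hd : d ≤ bordaGap P a) (h : History K L T) : d * pulls a h ≤ regret P h := by
  rw [pulls, regret, Finset.mul_sum]
  refine Finset.sum_le_sum fun t _ => ?_
  split_ifs with ht
  · rw [ht]; linarith
  · simpa using hP _

theorem mul_sub_pulls_le_regret {P : Arms K L} {a : Fin K} {d : ℝ} (hP : ∀ i, 0 ≤ bordaGap P i)
    (hd : ∀ i, i ≠ a → d ≤ bordaGap P i) (h : History K L T) :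
    d * (T - pulls a h) ≤ regret P h := by
  have hT : (T : ℝ) = ∑ _t : Fin T, 1 := by simp
  rw [pulls, regret, hT, ← Finset.sum_sub_distrib, Finset.mul_sum]
  refine Finset.sum_le_sum fun t _ => ?_
  split_ifs with ht
  · simpa using hP _
  · simpa using hd _ ht

/-- The change-of-measure bound: the arms other than `b` are the same in `P` and `Q`, arm `b` has
gap at least `e` in `P` and log-likelihood ratio of mean at most `κ`, arm `a` is optimal in `P` and
has gap at least `d` in `Q`. -/
theorem log_le_expectedRegret {alg : Algorithm K L} {P Q : Arms K L} {a b : Fin K} {d e κ : ℝ}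
    (ℓ : Fin K × Fin L → ℝ) (hℓ : ∀ a l, (Q a).1 l = (P a).1 l * Real.exp (-ℓ (a, l)))
    (hmean : ∀ i, ∑ l, (P i).1 l * ℓ (i, l) = if i = b then κ else 0)
    (hκ : 0 ≤ κ) (hd : 0 < d) (he : 0 < e)
    (hP : ∀ i, 0 ≤ bordaGap P i) (hPa : ∀ i, i ≠ a → d ≤ bordaGap P i) (hPb : e ≤ bordaGap P b)
    (hQ : ∀ i, 0 ≤ bordaGap Q i) (hQa : d ≤ bordaGap Q a)
    (hT : 0 < T) (hreg : expectedRegret alg Q T ≤ √T) :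
    Real.log T / 2 - 2 / d ≤
      expectedRegret alg P T * (κ / e + Real.log T / (d * T)) := by
  have hT0 : (0 : ℝ) < T := by exact_mod_cast hT
  have hlog : 0 ≤ Real.log T := Real.log_natCast_nonneg T
  set π := alg T
  set A : History K L T → ℝ := fun h => if (T : ℝ) / 2 ≤ pulls a h then 1 else 0 with hA
  -- The weight `log T / 2` turns into a factor `√T` after exponentiation, which the bound of order
  -- `1 / √T` on the `Q`-probability of the event cancels.
  have hcm := sum_historyProb_mul_sub_le (T := T) π P Q ℓ hℓ fun h => Real.log T / 2 * A h
  -- Wald's identity: information accrues only at pulls of `b`, at mean rate `κ`.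
  have hwald : ∑ h : History K L T, historyProb π P h * ∑ t, ℓ (h t) =
      κ * ∑ h : History K L T, historyProb π P h * pulls b h := by
    have h0 := sum_historyProb_mul_sum_eq_zero π P
      (fun x => ℓ x - κ * if x.1 = b then 1 else 0) (fun i => by
        simp only [mul_sub, Finset.sum_sub_distrib, hmean]
        split_ifs
        · rw [← Finset.sum_mul, (P i).2.2]
          ring
        · simp) T
    simp only [Finset.sum_sub_distrib, mul_sub, ← Finset.mul_sum] at h0
    rw [Finset.mul_sum]
    simp only [pulls]
    rw [sub_eq_zero] at h0
    rw [h0]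
    exact Finset.sum_congr rfl fun h _ => by ring
  have hb : e * ∑ h : History K L T, historyProb π P h * pulls b h ≤ expectedRegret alg P T := by
    rw [expectedRegret, Finset.mul_sum]
    refine Finset.sum_le_sum fun h _ => ?_
    have := mul_le_mul_of_nonneg_left (mul_pulls_le_regret hP hPb h) (historyProb_nonneg π P h)
    linarith
  have hp : d * T / 2 * (1 - ∑ h, historyProb π P h * A h) ≤ expectedRegret alg P T := by
    rw [expectedRegret, ← sum_historyProb π P T, ← Finset.sum_sub_distrib, Finset.mul_sum]
    refine Finset.sum_le_sum fun h _ => ?_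
    have h1 : d * T / 2 * (1 - A h) ≤ regret P h := by
      refine le_trans ?_ (mul_sub_pulls_le_regret hP hPa h)
      simp only [hA]
      have h2 : pulls a h ≤ T := by
        have : pulls a h ≤ ∑ _t : Fin T, (1 : ℝ) :=
          Finset.sum_le_sum fun t _ => by split_ifs <;> norm_num
        simpa using this
      split_ifs with hc
      · have := mul_nonneg hd.le (sub_nonneg.2 h2)
        linarith
      · have := mul_le_mul_of_nonneg_left (not_le.1 hc).le hd.le
        linarith
    have := mul_le_mul_of_nonneg_left h1 (historyProb_nonneg π P h)
    linarith
  have hq : d * T / 2 * ∑ h, historyProb π Q h * A h ≤ √T := by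
    refine le_trans ?_ hreg
    rw [expectedRegret, Finset.mul_sum]
    refine Finset.sum_le_sum fun h _ => ?_
    have h1 : d * T / 2 * A h ≤ regret Q h := by
      refine le_trans ?_ (mul_pulls_le_regret hQ hQa h)
      simp only [hA]
      split_ifs with hc
      · have := mul_le_mul_of_nonneg_left hc hd.le
        linarith
      · simpa using mul_nonneg hd.le (pulls_nonneg a h)
    have := mul_le_mul_of_nonneg_left h1 (historyProb_nonneg π Q h)
    linarith
  have hexp : ∑ h, historyProb π Q h * Real.exp (Real.log T / 2 * A h) - 1 ≤
      √T * ∑ h, historyProb π Q h * A h := by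
    rw [← sum_historyProb π Q T, ← Finset.sum_sub_distrib, Finset.mul_sum]
    refine Finset.sum_le_sum fun h _ => ?_
    have h1 : Real.exp (Real.log T / 2 * A h) ≤ 1 + √T * A h := by
      simp only [hA]
      split_ifs with hc
      · rw [mul_one, Real.exp_half, Real.exp_log hT0]
        linarith
      · simp
    have := mul_le_mul_of_nonneg_left h1 (historyProb_nonneg π Q h)
    linarith
  have hq' : √T * ∑ h, historyProb π Q h * A h ≤ 2 / d := by
    have h1 := mul_le_mul_of_nonneg_left hq (Real.sqrt_nonneg (T : ℝ))
    rw [Real.mul_self_sqrt hT0.le] at h1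
    rw [le_div_iff₀ hd]
    refine le_of_mul_le_mul_right ?_ hT0
    linarith
  simp only [mul_left_comm _ (Real.log T / 2), ← Finset.mul_sum] at hcm hexp
  rw [hwald] at hcm
  have hb' : κ * ∑ h : History K L T, historyProb π P h * pulls b h ≤
      expectedRegret alg P T * (κ / e) := by
    have := mul_le_mul_of_nonneg_left hb (div_nonneg hκ he.le)
    calc _ = κ / e * (e * ∑ h : History K L T, historyProb π P h * pulls b h) := by field_simp
      _ ≤ _ := by linarith
  have hp' : Real.log T / 2 * (1 - ∑ h, historyProb π P h * A h) ≤
      expectedRegret alg P T * (Real.log T / (d * T)) := by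
    have := mul_le_mul_of_nonneg_left hp (div_nonneg hlog (mul_pos hd hT0).le)
    calc _ = Real.log T / (d * T) * (d * T / 2 * (1 - ∑ h, historyProb π P h * A h)) := by
          field_simp
      _ ≤ _ := by linarith
  linarith

/-! ### The hard pair of instances -/

theorem vec_mem_stdSimplex {x y z : ℝ} (hx : 0 ≤ x) (hy : 0 ≤ y) (hz : 0 ≤ z)
    (h : x + y + z = 1) : ![x, y, z] ∈ stdSimplex ℝ (Fin 3) := by
  refine ⟨fun i => ?_, by simpa [Fin.sum_univ_three] using h⟩
  fin_cases i <;> simpa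

/-- Three arms of which the last, an inferior one, decides by its parameter `q` which of the two
others is the Borda winner. -/
noncomputable def hardArms (q : ℝ) (h0 : 0 ≤ q) (h1 : q ≤ 1) : Arms 3 3 :=
  -- The weights 5/11 and 6/11 of arm 1 make arms 0 and 1 tie exactly at `q = 1 / 2`.
  ![⟨![0, 1, 0], vec_mem_stdSimplex (by norm_num) (by norm_num) (by norm_num) (by norm_num)⟩,
    ⟨![5 / 11, 0, 6 / 11],
      vec_mem_stdSimplex (by norm_num) (by norm_num) (by norm_num) (by norm_num)⟩,
    ⟨![q, 1 - q, 0], vec_mem_stdSimplex h0 (by linarith) le_rfl (by ring)⟩]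

theorem bordaScore_hardArms {q : ℝ} (h0 : 0 ≤ q) (h1 : q ≤ 1) :
    bordaScore (hardArms q h0 h1) = ![(21 + 11 * q) / 44, (24 + 5 * q) / 44, (21 - 16 * q) / 44] := by
  have e0 : (Finset.univ : Finset (Fin 3)).erase 0 = {1, 2} := by decide
  have e1 : (Finset.univ : Finset (Fin 3)).erase 1 = {0, 2} := by decide
  have e2 : (Finset.univ : Finset (Fin 3)).erase 2 = {0, 1} := by decide
  funext i
  fin_cases i
  · simp [bordaScore, e0, winProb, hardArms, Fin.sum_univ_three]
    ring
  · simp [bordaScore, e1, winProb, hardArms, Fin.sum_univ_three]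
    ring
  · simp [bordaScore, e2, winProb, hardArms, Fin.sum_univ_three]
    ring

theorem bordaGap_hardArms_of_half_le {q : ℝ} (h0 : 0 ≤ q) (h1 : q ≤ 1) (hq : 1 / 2 ≤ q) :
    IsBordaWinner (hardArms q h0 h1) 0 ∧
      bordaGap (hardArms q h0 h1) = ![0, (6 * q - 3) / 44, 27 * q / 44] := by
  have hw : IsBordaWinner (hardArms q h0 h1) 0 := by
    intro i
    rw [bordaScore_hardArms]
    fin_cases i <;> simp <;> linarith
  refine ⟨hw, ?_⟩
  funext i
  rw [bordaGap_eq_of_isBordaWinner hw, bordaScore_hardArms]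
  fin_cases i <;> simp <;> ring

theorem bordaGap_hardArms_of_le_half {q : ℝ} (h0 : 0 ≤ q) (h1 : q ≤ 1) (hq : q ≤ 1 / 2) :
    bordaGap (hardArms q h0 h1) = ![(3 - 6 * q) / 44, 0, (3 + 21 * q) / 44] := by
  have hw : IsBordaWinner (hardArms q h0 h1) 1 := by
    intro i
    rw [bordaScore_hardArms]
    fin_cases i <;> simp <;> linarith
  funext i
  rw [bordaGap_eq_of_isBordaWinner hw, bordaScore_hardArms]
  fin_cases i <;> simp <;> ring

/-- The log-likelihood ratio between the hard instances with parameters `q` and `1 - q`. -/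
noncomputable def hardLogRatio (q : ℝ) (x : Fin 3 × Fin 3) : ℝ :=
  if x.1 = 2 then ![Real.log (q / (1 - q)), -Real.log (q / (1 - q)), 0] x.2 else 0

/-- Arm 2 never yields level 2, so the value 0 of the ratio there is harmless. -/
theorem hardArms_one_sub {q : ℝ} (h0 : 0 < q) (h1 : q < 1) (a l : Fin 3) :
    (hardArms (1 - q) (by linarith) (by linarith) a).1 l =
      (hardArms q h0.le h1.le a).1 l * Real.exp (-hardLogRatio q (a, l)) := by
  have h1' : 0 < 1 - q := sub_pos.2 h1
  fin_cases a
  · simp [hardArms, hardLogRatio]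
  · simp [hardArms, hardLogRatio]
  · fin_cases l <;> simp [hardArms, hardLogRatio, Real.exp_neg, Real.exp_log (div_pos h0 h1')] <;>
      field_simp

theorem sum_hardArms_mul_hardLogRatio {q : ℝ} (h0 : 0 ≤ q) (h1 : q ≤ 1) (i : Fin 3) :
    ∑ l, (hardArms q h0 h1 i).1 l * hardLogRatio q (i, l) =
      if i = 2 then (2 * q - 1) * Real.log (q / (1 - q)) else 0 := by
  fin_cases i
  · simp [hardLogRatio]
  · simp [hardLogRatio]
  · simp [hardArms, hardLogRatio, Fin.sum_univ_three]
    ring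

theorem eventually_log_le_mul {ε : ℝ} (hε : 0 < ε) :
    ∀ᶠ T : ℕ in atTop, Real.log T ≤ ε * T := by
  have h := (Real.isLittleO_log_id_atTop.comp_tendsto tendsto_natCast_atTop_atTop).bound hε
  filter_upwards [h] with T hT
  simp only [Function.comp, id, Real.norm_eq_abs, Nat.abs_cast] at hT
  exact (le_abs_self _).trans hT

end QDB

/-! ### Choice of constants -/

theorem theorem4 :
    ∃ (L : ℕ) (c Δ₀ : ℝ), 0 < c ∧ 0 < Δ₀ ∧
      ∀ Δ : ℝ, 0 < Δ → Δ < Δ₀ →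
        ∃ Γ Θ : QDB.Arms 3 L, QDB.IsMinBordaGap Θ Δ ∧
          ∀ alg : QDB.Algorithm 3 L,
            (∀ a : ℝ, 0 < a →
              (fun T : ℕ => QDB.expectedRegret alg Γ T) =o[atTop] (fun T : ℕ => (T : ℝ) ^ a)) →
            ((c / Δ ^ 2 : ℝ) : EReal) ≤
              liminf (fun T : ℕ => ((QDB.expectedRegret alg Θ T / Real.log T : ℝ) : EReal))
                atTop := by
  refine ⟨3, 1 / 16000, 1 / 100, by norm_num, by norm_num, fun Δ hΔ hΔ' => ?_⟩
  -- Solves `(6 * q - 3) / 44 = Δ`, the gap of arm 1 in `Θ`.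
  obtain ⟨q, hq⟩ : ∃ q, q = 1 / 2 + 22 / 3 * Δ := ⟨_, rfl⟩
  have h0 : 0 < q := by linarith
  have h1 : q < 1 := by linarith
  obtain ⟨hwin, hgapΘ⟩ := bordaGap_hardArms_of_half_le h0.le h1.le (by linarith)
  have hgapΓ := bordaGap_hardArms_of_le_half (q := 1 - q) (by linarith) (by linarith) (by linarith)
  refine ⟨hardArms (1 - q) (by linarith) (by linarith), hardArms q h0.le h1.le,
    ⟨0, hwin, ⟨1, by simp, ?_⟩, ?_⟩, fun alg halg => ?_⟩
  · rw [hgapΘ, hq]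
    simp
    ring
  · rintro _ ⟨i, hi, rfl⟩
    rw [hgapΘ, hq]
    fin_cases i
    · simp at hi
    · simp; linarith
    · simp; linarith
  refine le_liminf_of_le (by isBoundedDefault) ?_
  have hκ0 : 0 ≤ Real.log (q / (1 - q)) :=
    Real.log_nonneg (by rw [le_div_iff₀ (by linarith)]; linarith)
  have hκ1 : Real.log (q / (1 - q)) ≤ 60 * Δ := by
    refine (Real.log_le_sub_one_of_pos (div_pos h0 (by linarith))).trans ?_
    rw [div_sub_one (by linarith), div_le_iff₀ (by linarith), hq]
    nlinarith
  -- Then `2 / Δ` costs at most half of `log T / 2`; the remaining `log T / 4` against the factor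
  -- `4000 * Δ ^ 2` gives 1/16000.
  have hlog : ∀ᶠ T : ℕ in atTop, 8 / Δ ≤ Real.log T :=
    (Real.tendsto_log_atTop.comp tendsto_natCast_atTop_atTop).eventually_ge_atTop _
  filter_upwards [eventually_log_le_mul (pow_pos hΔ 3), hlog, eventually_gt_atTop 1,
    (halg (1 / 2) (by norm_num)).bound one_pos] with T hT hlogT hT1 hreg
  have hT0 : (0 : ℝ) < T := by exact_mod_cast (zero_lt_one.trans hT1)
  have hl : 0 < Real.log T := Real.log_pos (by exact_mod_cast hT1)
  have hmain := log_le_expectedRegret (alg := alg) (T := T) (a := 0) (b := 2) (d := Δ)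
    (e := 1 / 4) (κ := (2 * q - 1) * Real.log (q / (1 - q)))
    (hardLogRatio q) (hardArms_one_sub h0 h1) (sum_hardArms_mul_hardLogRatio h0.le h1.le)
    (mul_nonneg (by linarith) hκ0) hΔ (by norm_num)
    (fun i => by rw [hgapΘ]; fin_cases i <;> simp <;> linarith)
    (fun i hi => by
      rw [hgapΘ]
      fin_cases i
      · simp at hi
      · simp; linarith
      · simp; linarith)
    (by rw [hgapΘ]; simp; linarith)
    (fun i => by rw [hgapΓ]; fin_cases i <;> simp <;> linarith)
    (by rw [hgapΓ]; simp; linarith)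
    (zero_lt_one.trans hT1)
    (by
      refine (le_abs_self _).trans (hreg.trans_eq ?_)
      rw [one_mul, Real.norm_eq_abs, ← Real.sqrt_eq_rpow, abs_of_nonneg (Real.sqrt_nonneg _)])
  have hR : 0 ≤ expectedRegret alg (hardArms q h0.le h1.le) T :=
    Finset.sum_nonneg fun h _ => mul_nonneg (historyProb_nonneg _ _ _)
      (Finset.sum_nonneg fun t _ => by
        rw [hgapΘ]
        generalize (h t).1 = i
        fin_cases i <;> simp <;> linarith)
  -- The terms are at most `4 * 880 * Δ ^ 2` and `Δ ^ 2`.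
  have hfac : (2 * q - 1) * Real.log (q / (1 - q)) / (1 / 4) + Real.log T / (Δ * T) ≤
      4000 * Δ ^ 2 := by
    have e1 : Real.log T / (Δ * T) ≤ Δ ^ 2 := by
      rw [div_le_iff₀ (mul_pos hΔ hT0)]
      linarith
    have e2 : (2 * q - 1) * Real.log (q / (1 - q)) ≤ 44 / 3 * Δ * (60 * Δ) := by
      have : 2 * q - 1 = 44 / 3 * Δ := by rw [hq]; ring
      rw [this]
      exact mul_le_mul_of_nonneg_left hκ1 (by positivity)
    nlinarith
  have hfin := hmain.trans (mul_le_mul_of_nonneg_left hfac hR)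
  have h8 : 8 / Δ = 4 * (2 / Δ) := by ring
  rw [EReal.coe_le_coe_iff, div_le_div_iff₀ (pow_pos hΔ 2) hl]
  linarith
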